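/- A \emph{tall tile} is a closed, simply connected (simple) polygon in $\mathbb R^2$ with all sides parallel to the axes and of height $1$ (side lengths may be irrational). For a finite set $T$ of tall tiles and a region $\Gamma$, a \emph{tiling} of $\Gamma$ with $T$ is a collection of translates of tiles in $T$ which do not overlap except along their boundaries and whose union is $\Gamma$. For $a>0$ let $R_a$ be the rectangle of height $1$ and length $a$, and let $R_0$ be the empty region, which has exactly one (empty) tiling. A function $f:\mathbb N\to\mathbb N$, where $\mathbb N=\{0,1,2,\dots\}$, is a \emph{tile counting function} if there are a finite set $T$ of tall tiles and a real number $\delta\ge 0$ such that, for every $n\in\mathbb N$, $f(n)$ is the number of tilings of $R_{n+\delta}$ with $T$. Let $C_n=\frac1{n+1}\binom{2n}{n}$ be the Catalan numbers. For every $\varepsilon>0$ there exist a tile counting function $f$ and a real number $A\in(1-\varepsilon,1+\varepsilon)$ such that $f(n)\sim A\,C_n$, that is, $\dfrac{f(n)}{A\,C_n}\to 1$ as $n\to\infty$. -/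

import Mathlib

open Filter Topology

namespace IrrationalTilings

/-- A (closed, simple) axis-parallel polygon in the plane: a finite union of nondegenerate closed
axis-parallel boxes which is simply connected and whose interior is connected. The last condition
excludes figures pinched at a point, such as two squares that share only a corner. -/
def IsAxisPolygon (τ : Set (ℝ × ℝ)) : Prop :=
  (∃ B : Set (Set (ℝ × ℝ)), B.Finite ∧
    (∀ R ∈ B, ∃ a b c d : ℝ, a < b ∧ c < d ∧ R = Set.Icc a b ×ˢ Set.Icc c d) ∧
    τ = ⋃₀ B) ∧
  IsSimplyConnected τ ∧
  IsConnected (interior τ)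

/-- A tall tile: an axis-parallel polygon of height `1`. -/
def IsTallTile (τ : Set (ℝ × ℝ)) : Prop :=
  IsAxisPolygon τ ∧ ∃ b : ℝ, Prod.snd '' τ = Set.Icc b (b + 1)

/-- `P` is a tiling of the region `Γ` with the set of tiles `T`: a finite collection of translates
of tiles from `T`, no two of which overlap (they may share boundary points), with union `Γ`. -/
def IsTiling (T : Set (Set (ℝ × ℝ))) (Γ : Set (ℝ × ℝ)) (P : Set (Set (ℝ × ℝ))) : Prop :=
  P.Finite ∧
  (∀ σ ∈ P, ∃ τ ∈ T, ∃ v : ℝ × ℝ, σ = (fun p => v + p) '' τ) ∧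
  (∀ σ ∈ P, ∀ σ' ∈ P, σ ≠ σ' → Disjoint (interior σ) (interior σ')) ∧
  ⋃₀ P = Γ

/-- The rectangle of height `1` and length `a`. For `a = 0` this is the empty region (not a
segment), which has exactly one tiling, the empty one. -/
def strip (a : ℝ) : Set (ℝ × ℝ) :=
  {p | 0 < a ∧ p.1 ∈ Set.Icc 0 a ∧ p.2 ∈ Set.Icc 0 1}

/-- `f` is a tile counting function: for some finite set `T` of tall tiles and some `ε ≥ 0`,
`f n` is the number of tilings with `T` of the rectangle of height `1` and length `n + ε`.
(`Set.encard` takes the value `⊤` on infinite sets, so the number of tilings is finite here.) -/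
def IsTileCountingFunction (f : ℕ → ℕ) : Prop :=
  ∃ (T : Set (Set (ℝ × ℝ))) (ε : ℝ), T.Finite ∧ (∀ τ ∈ T, IsTallTile τ) ∧ 0 ≤ ε ∧
    ∀ n : ℕ, Set.encard {P | IsTiling T (strip (n + ε)) P} = f n

/-- `f ∼ g`: the ratio `f n / g n` tends to `1` as `n → ∞`. -/
def AsymptoticTo (f g : ℕ → ℝ) : Prop :=
  Tendsto (fun n => f n / g n) atTop (𝓝 1)

end IrrationalTilings

/-!
All tiles used are rectangles of height `1`, so a tiling of the strip is a word in the tile lengths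
with prescribed sum. Take eight base lengths whose only rational relation is that their sum is `12`,
namely seven powers of a small transcendental number and their complement to `12`, and pairs of
marker lengths whose sum is an integer plus `δ`, again with no other relation. A tiling of the strip
of length `n + δ` then uses each base length equally often, say `k` times, and exactly one pair of
markers, which leaves `(8 * k + 2)! / k ! ^ 8` words for each pair that fits.

By Stirling's formula the eight equinumerous letters contribute `(8 ^ 8) ^ k * k ^ (-7 / 2)` and the
two markers a factor `k ^ 2`. As `8 ^ 8 = 4 ^ 12`, the product has the order of
`4 ^ (12 * k) * (12 * k) ^ (-3 / 2)`, the order of the Catalan number of index `12 * k`. Taking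
`M * 4 ^ j` pairs of markers with integer part `12 * s + j`, for `j < 12`, interpolates between the
multiples of `12`, and `M` and `s` can be chosen to bring the constant close to `1`.
-/

namespace IrrationalTilings

section Rectangles

/-- The rectangle of height `1` and length `a` with lower left corner `(x, 0)`: the shape of every
tile used here. -/
def rect (x a : ℝ) : Set (ℝ × ℝ) := Set.Icc x (x + a) ×ˢ Set.Icc 0 1

/-- The strip of length `a` that starts at abscissa `x`. As for `strip`, length `0` gives the empty
region. -/
def stripFrom (x a : ℝ) : Set (ℝ × ℝ) :=
  {p | 0 < a ∧ p.1 ∈ Set.Icc x (x + a) ∧ p.2 ∈ Set.Icc 0 1}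

/-- The row of rectangles with the lengths listed in a word, placed side by side from abscissa `x`
on. -/
def row : ℝ → List ℝ → Set (Set (ℝ × ℝ))
  | _, [] => ∅
  | x, a :: l => insert (rect x a) (row (x + a) l)

variable {x y a b : ℝ}

theorem strip_eq_stripFrom (a : ℝ) : strip a = stripFrom 0 a := by
  simp only [strip, stripFrom, zero_add]

theorem stripFrom_of_pos (x : ℝ) (ha : 0 < a) : stripFrom x a = rect x a := by
  ext p
  simp only [stripFrom, rect, Set.mem_ofPred_eq, Set.mem_prod, ha, true_and]

theorem stripFrom_zero (x : ℝ) : stripFrom x 0 = ∅ := by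
  simp [stripFrom]

theorem isClosed_rect (x a : ℝ) : IsClosed (rect x a) :=
  isClosed_Icc.prod isClosed_Icc

theorem interior_rect (x a : ℝ) :
    interior (rect x a) = Set.Ioo x (x + a) ×ˢ Set.Ioo 0 1 := by
  rw [rect, interior_prod_eq, interior_Icc, interior_Icc]

theorem left_mem_rect (x : ℝ) (ha : 0 ≤ a) : (x, 0) ∈ rect x a :=
  ⟨⟨le_rfl, by linarith⟩, le_rfl, zero_le_one⟩

theorem right_mem_rect (x : ℝ) (ha : 0 ≤ a) : (x + a, 0) ∈ rect x a :=
  ⟨⟨by linarith, le_rfl⟩, le_rfl, zero_le_one⟩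

theorem image_add_rect (v : ℝ × ℝ) (x a : ℝ) :
    (fun p => v + p) '' rect x a =
      Set.Icc (v.1 + x) (v.1 + x + a) ×ˢ Set.Icc v.2 (v.2 + 1) := by
  have hprod : (fun p => v + p) = Prod.map (fun s => v.1 + s) (fun s => v.2 + s) := rfl
  rw [hprod, rect, Set.prodMap_image_prod, Set.image_const_add_Icc, Set.image_const_add_Icc,
    add_zero, add_assoc]

theorem isTallTile_rect (x : ℝ) (ha : 0 < a) : IsTallTile (rect x a) := by
  have hconvex : Convex ℝ (rect x a) := (convex_Icc _ _).prod (convex_Icc _ _)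
  refine ⟨⟨⟨{rect x a}, Set.finite_singleton _, ?_, by simp⟩, ?_, ?_⟩, 0, ?_⟩
  · rintro R rfl
    exact ⟨x, x + a, 0, 1, by linarith, one_pos, rfl⟩
  · have := hconvex.contractibleSpace ⟨_, left_mem_rect x ha.le⟩
    exact (inferInstance : SimplyConnectedSpace (rect x a))
  · refine ⟨?_, hconvex.interior.isPreconnected⟩
    rw [interior_rect]
    exact (Set.nonempty_Ioo.2 (by linarith)).prod (Set.nonempty_Ioo.2 one_pos)
  · rw [rect, Set.snd_image_prod (Set.nonempty_Icc.2 (by linarith)), zero_add]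

theorem disjoint_interior_rect (h : x + a ≤ y) :
    Disjoint (interior (rect x a)) (interior (rect y b)) := by
  simp only [interior_rect]
  exact Set.disjoint_prod.2 <| Or.inl <| Set.Ioo_disjoint_Ioo.2 <|
    (min_le_left _ _).trans (h.trans (le_max_right _ _))

theorem add_le_of_disjoint_interior_rect (hb : 0 < b) (hxy : x ≤ y)
    (h : Disjoint (interior (rect x a)) (interior (rect y b))) : x + a ≤ y := by
  simp only [interior_rect] at h
  have hunit : ¬ Disjoint (Set.Ioo (0 : ℝ) 1) (Set.Ioo 0 1) := by
    rw [disjoint_self]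
    exact (Set.nonempty_Ioo.2 one_pos).ne_empty
  have h' := Set.Ioo_disjoint_Ioo.1 <| (Set.disjoint_prod.1 h).resolve_right hunit
  rw [max_eq_right hxy, min_le_iff] at h'
  exact h'.resolve_right (by linarith)

theorem rect_inj (ha : 0 ≤ a) (hb : 0 ≤ b) : rect x a = rect y b ↔ x = y ∧ a = b := by
  refine ⟨fun h => ?_, by rintro ⟨rfl, rfl⟩; rfl⟩
  have hx : (x, (0 : ℝ)) ∈ rect y b := h ▸ left_mem_rect x ha
  have hy : (y, (0 : ℝ)) ∈ rect x a := h ▸ left_mem_rect y hb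
  have hxa : (x + a, (0 : ℝ)) ∈ rect y b := h ▸ right_mem_rect x ha
  have hyb : (y + b, (0 : ℝ)) ∈ rect x a := h ▸ right_mem_rect y hb
  have hxy : x = y := le_antisymm hy.1.1 hx.1.1
  exact ⟨hxy, by linarith [hxa.1.2, hyb.1.2]⟩

end Rectangles

section Rows

variable {L : Set ℝ} {x a b : ℝ} {l : List ℝ} {σ : Set (ℝ × ℝ)} {P : Set (Set (ℝ × ℝ))}

theorem finite_row (x : ℝ) (l : List ℝ) : (row x l).Finite := by
  induction l generalizing x with
  | nil => exact Set.finite_empty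
  | cons a l ih => exact (ih _).insert _

theorem exists_eq_rect_of_mem_row (hl : ∀ a ∈ l, 0 < a) (hσ : σ ∈ row x l) :
    ∃ y, ∃ a ∈ l, σ = rect y a ∧ x ≤ y := by
  induction l generalizing x with
  | nil => exact hσ.elim
  | cons b l ih =>
    obtain ⟨hb, hl⟩ := List.forall_mem_cons.1 hl
    rcases hσ with rfl | hσ
    · exact ⟨x, b, List.mem_cons_self, rfl, le_rfl⟩
    · obtain ⟨y, a, ha, rfl, hy⟩ := ih hl hσ
      exact ⟨y, a, List.mem_cons_of_mem _ ha, rfl, by linarith⟩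

theorem rect_notMem_row (ha : 0 ≤ a) (hb : 0 < b) (hl : ∀ a ∈ l, 0 < a) :
    rect x a ∉ row (x + b) l := by
  intro hmem
  obtain ⟨y, c, hc, heq, hy⟩ := exists_eq_rect_of_mem_row hl hmem
  linarith [((rect_inj ha (hl c hc).le).1 heq).1]

theorem rect_union_stripFrom (hb : 0 < b) (ha : 0 ≤ a) :
    rect x b ∪ stripFrom (x + b) a = stripFrom x (b + a) := by
  rcases ha.eq_or_lt with rfl | ha
  · rw [stripFrom_zero, Set.union_empty, add_zero, stripFrom_of_pos x hb]
  · rw [stripFrom_of_pos _ ha, stripFrom_of_pos _ (add_pos hb ha), rect, rect, rect,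
      ← Set.union_prod, Set.Icc_union_Icc_eq_Icc (by linarith) (by linarith), add_assoc]

theorem sUnion_row (x : ℝ) (hl : ∀ a ∈ l, 0 < a) : ⋃₀ row x l = stripFrom x l.sum := by
  induction l generalizing x with
  | nil => simp [row, stripFrom_zero]
  | cons b l ih =>
    obtain ⟨hb, hl⟩ := List.forall_mem_cons.1 hl
    rw [row, Set.sUnion_insert, ih _ hl, List.sum_cons,
      rect_union_stripFrom hb (List.sum_nonneg fun a ha => (hl a ha).le)]

theorem pairwise_disjoint_interior_row (x : ℝ) (hl : ∀ a ∈ l, 0 < a) :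
    (row x l).Pairwise fun σ σ' => Disjoint (interior σ) (interior σ') := by
  induction l generalizing x with
  | nil => exact Set.pairwise_empty _
  | cons b l ih =>
    obtain ⟨-, hl⟩ := List.forall_mem_cons.1 hl
    refine (ih _ hl).insert fun σ hσ _ => ?_
    obtain ⟨y, a, -, rfl, hy⟩ := exists_eq_rect_of_mem_row hl hσ
    exact ⟨disjoint_interior_rect hy, (disjoint_interior_rect hy).symm⟩

theorem isTiling_row (x : ℝ) (hL : ∀ a ∈ L, 0 < a) (hl : ∀ a ∈ l, a ∈ L) :
    IsTiling (rect 0 '' L) (stripFrom x l.sum) (row x l) := by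
  have hpos : ∀ a ∈ l, 0 < a := fun a ha => hL a (hl a ha)
  refine ⟨finite_row x l, fun σ hσ => ?_,
    fun σ hσ σ' hσ' => pairwise_disjoint_interior_row x hpos hσ hσ', sUnion_row x hpos⟩
  obtain ⟨y, a, ha, rfl, -⟩ := exists_eq_rect_of_mem_row hpos hσ
  refine ⟨_, Set.mem_image_of_mem _ (hl a ha), (y, 0), ?_⟩
  rw [image_add_rect, add_zero, zero_add, rect]

theorem injOn_row (x : ℝ) : Set.InjOn (row x) {l | ∀ a ∈ l, 0 < a} := by
  intro l hl l' hl' h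
  induction l generalizing x l' with
  | nil =>
    cases l' with
    | nil => rfl
    | cons b l' => exact absurd h.symm (Set.insert_nonempty _ _).ne_empty
  | cons a l ih =>
    cases l' with
    | nil => exact absurd h (Set.insert_nonempty _ _).ne_empty
    | cons b l' =>
      obtain ⟨ha, hpos⟩ := List.forall_mem_cons.1 hl
      obtain ⟨hb, hpos'⟩ := List.forall_mem_cons.1 hl'
      obtain rfl : a = b := by
        have hmem : rect x a ∈ row x (b :: l') := h ▸ Set.mem_insert _ _
        exact ((rect_inj ha.le hb.le).1
          (hmem.resolve_right (rect_notMem_row ha.le hb hpos'))).2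
      have htail : row (x + a) l = row (x + a) l' := by
        rw [← Set.insert_sdiff_self_of_notMem (rect_notMem_row ha.le ha hpos),
          ← Set.insert_sdiff_self_of_notMem (rect_notMem_row ha.le ha hpos')]
        exact congrArg (· \ {rect x a}) h
      rw [ih (x + a) hpos hpos' htail]

theorem IsTiling.exists_eq_rect (hL : ∀ a ∈ L, 0 < a)
    (hP : IsTiling (rect 0 '' L) (stripFrom x a) P) (hσ : σ ∈ P) :
    ∃ y, ∃ b ∈ L, σ = rect y b ∧ x ≤ y ∧ y + b ≤ x + a := by
  have hsub : σ ⊆ stripFrom x a := hP.2.2.2 ▸ Set.subset_sUnion_of_mem hσ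
  obtain ⟨_, ⟨b, hb, rfl⟩, v, rfl⟩ := hP.2.1 σ hσ
  have hb0 := (hL b hb).le
  rw [image_add_rect, add_zero] at hsub ⊢
  obtain ⟨-, ⟨hleft, -⟩, hbottom, -⟩ :=
    @hsub (v.1, v.2) ⟨Set.left_mem_Icc.2 (by linarith), Set.left_mem_Icc.2 (by linarith)⟩
  obtain ⟨-, ⟨-, hright⟩, -, htop⟩ :=
    @hsub (v.1 + b, v.2 + 1) ⟨Set.right_mem_Icc.2 (by linarith), Set.right_mem_Icc.2 (by linarith)⟩
  have hv : v.2 = 0 := le_antisymm (by simpa using htop) hbottom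
  exact ⟨v.1, b, hb, by rw [hv, rect, zero_add], hleft, hright⟩

theorem IsTiling.exists_rect_left_mem (hL : ∀ a ∈ L, 0 < a) (ha : 0 < a)
    (hP : IsTiling (rect 0 '' L) (stripFrom x a) P) : ∃ b ∈ L, b ≤ a ∧ rect x b ∈ P := by
  have hcorner : (x, (0 : ℝ)) ∈ ⋃₀ P := by
    rw [hP.2.2.2, stripFrom_of_pos x ha]
    exact left_mem_rect x ha.le
  obtain ⟨σ, hσ, hxσ⟩ := hcorner
  obtain ⟨y, b, hb, rfl, hxy, hyb⟩ := hP.exists_eq_rect hL hσ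
  obtain rfl : y = x := le_antisymm hxσ.1.1 hxy
  exact ⟨b, hb, by linarith, hσ⟩

theorem IsTiling.sUnion_diff_rect (hL : ∀ a ∈ L, 0 < a)
    (hP : IsTiling (rect 0 '' L) (stripFrom x a) P) (hb : b ∈ L) (hmem : rect x b ∈ P) :
    ⋃₀ (P \ {rect x b}) = stripFrom (x + b) (a - b) := by
  have hb0 := hL b hb
  refine Set.Subset.antisymm ?_ ?_
  · rintro p ⟨σ, ⟨hσ, hne⟩, hp⟩
    obtain ⟨y, c, hc, rfl, hxy, hyc⟩ := hP.exists_eq_rect hL hσ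
    have hc0 := hL c hc
    have hby : x + b ≤ y :=
      add_le_of_disjoint_interior_rect hc0 hxy (hP.2.2.1 _ hmem _ hσ (Ne.symm hne))
    exact ⟨by linarith, ⟨hby.trans hp.1.1, by linarith [hp.1.2]⟩, hp.2⟩
  · intro p hp
    have hpos : 0 < a - b := hp.1
    rw [stripFrom_of_pos _ hpos] at hp
    have hclosed : IsClosed (⋃₀ (P \ {rect x b})) := by
      rw [Set.sUnion_eq_biUnion]
      refine (hP.1.subset Set.sdiff_subset).isClosed_biUnion fun σ hσ => ?_
      obtain ⟨y, c, -, rfl, -⟩ := hP.exists_eq_rect hL hσ.1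
      exact isClosed_rect y c
    have hsub : Set.Ioc (x + b) (x + b + (a - b)) ×ˢ Set.Icc (0 : ℝ) 1 ⊆
        ⋃₀ (P \ {rect x b}) := by
      rintro q ⟨⟨hleft, hright⟩, hq⟩
      obtain ⟨σ, hσ, hqσ⟩ : q ∈ ⋃₀ P :=
        hP.2.2.2 ▸ ⟨by linarith, ⟨by linarith, by linarith⟩, hq⟩
      refine ⟨σ, ⟨hσ, ?_⟩, hqσ⟩
      rintro rfl
      exact hleft.not_ge hqσ.1.2
    have hclosure := hclosed.closure_subset_iff.2 hsub
    rw [closure_prod_eq, closure_Ioc (by linarith), closure_Icc] at hclosure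
    exact hclosure hp

theorem IsTiling.diff_rect (hL : ∀ a ∈ L, 0 < a)
    (hP : IsTiling (rect 0 '' L) (stripFrom x a) P) (hb : b ∈ L) (hmem : rect x b ∈ P) :
    IsTiling (rect 0 '' L) (stripFrom (x + b) (a - b)) (P \ {rect x b}) :=
  ⟨hP.1.subset Set.sdiff_subset, fun σ hσ => hP.2.1 σ hσ.1,
    fun σ hσ σ' hσ' => hP.2.2.1 σ hσ.1 σ' hσ'.1, hP.sUnion_diff_rect hL hb hmem⟩

theorem IsTiling.exists_row_eq (hL : ∀ a ∈ L, 0 < a) (ha : 0 ≤ a)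
    (hP : IsTiling (rect 0 '' L) (stripFrom x a) P) :
    ∃ l : List ℝ, (∀ b ∈ l, b ∈ L) ∧ l.sum = a ∧ row x l = P := by
  induction hN : P.ncard generalizing P x a with
  | zero =>
    obtain rfl : P = ∅ := (Set.ncard_eq_zero hP.1).1 hN
    rcases ha.eq_or_lt with rfl | ha
    · exact ⟨[], by simp, rfl, rfl⟩
    · obtain ⟨_, _, _, hmem⟩ := hP.exists_rect_left_mem hL ha
      exact hmem.elim
  | succ N ih =>
    have ha : 0 < a := by
      obtain ⟨σ, hσ⟩ := Set.nonempty_of_ncard_ne_zero (by omega : P.ncard ≠ 0)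
      obtain ⟨y, b, hb, -, hxy, hyb⟩ := hP.exists_eq_rect hL hσ
      linarith [hL b hb]
    obtain ⟨b, hb, hba, hmem⟩ := hP.exists_rect_left_mem hL ha
    obtain ⟨l, hl, hsum, hrow⟩ := ih (sub_nonneg.2 hba) (hP.diff_rect hL hb hmem)
      (by rw [Set.ncard_sdiff_singleton_of_mem hmem, hN, Nat.add_sub_cancel])
    refine ⟨b :: l, List.forall_mem_cons.2 ⟨hb, hl⟩, by rw [List.sum_cons, hsum]; ring, ?_⟩
    rw [row, hrow, Set.insert_sdiff_singleton, Set.insert_eq_of_mem hmem]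

theorem encard_setOf_isTiling_strip (hL : ∀ a ∈ L, 0 < a) (ha : 0 ≤ a) :
    {P | IsTiling (rect 0 '' L) (strip a) P}.encard =
      {l : List ℝ | (∀ b ∈ l, b ∈ L) ∧ l.sum = a}.encard := by
  have himage : {P | IsTiling (rect 0 '' L) (strip a) P} =
      row 0 '' {l : List ℝ | (∀ b ∈ l, b ∈ L) ∧ l.sum = a} := by
    ext P
    rw [strip_eq_stripFrom]
    constructor
    · intro hP
      obtain ⟨l, hl, hsum, hrow⟩ := IsTiling.exists_row_eq hL ha hP
      exact ⟨l, ⟨hl, hsum⟩, hrow⟩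
    · rintro ⟨l, ⟨hl, rfl⟩, rfl⟩
      exact isTiling_row 0 hL hl
  have hinj : Set.InjOn (row 0) {l : List ℝ | (∀ b ∈ l, b ∈ L) ∧ l.sum = a} :=
    (injOn_row 0).mono fun l hl b hb => hL b (hl.1 b hb)
  rw [himage, hinj.encard_image]

theorem encard_setOf_isTiling_strip_range {J : Type*} {len : J → ℝ} (hpos : ∀ j, 0 < len j)
    (hinj : Function.Injective len) (ha : 0 ≤ a) :
    {P | IsTiling (rect 0 '' Set.range len) (strip a) P}.encard =
      {w : List J | (w.map len).sum = a}.encard := by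
  rw [encard_setOf_isTiling_strip (Set.forall_mem_range.2 hpos) ha,
    ← (List.map_injective_iff.2 hinj).encard_image]
  congr 1
  ext l
  have hrange : (∀ b ∈ l, b ∈ Set.range len) ↔ l ∈ Set.range (List.map len) := by
    rw [Set.range_list_map]; rfl
  rw [Set.mem_ofPred_eq, hrange]
  constructor
  · rintro ⟨⟨w, rfl⟩, hw⟩
    exact ⟨w, hw, rfl⟩
  · rintro ⟨w, hw, rfl⟩
    exact ⟨⟨w, rfl⟩, hw⟩

end Rows

section Words

variable {J : Type*}

theorem sum_map_eq_sum_count {R : Type*} [Fintype J] [DecidableEq J] [NonAssocSemiring R]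
    (w : List J) (f : J → R) :
    (w.map f).sum = ∑ j, w.count j * f j := by
  rw [Finset.sum_list_map_count, ← Finset.sum_subset (Finset.subset_univ w.toFinset)]
  · simp only [nsmul_eq_mul]
  · intro j _ hj
    rw [List.count_eq_zero.2 (mt List.mem_toFinset.2 hj), Nat.cast_zero, zero_mul]

theorem prod_map_X_eq_monomial [DecidableEq J] (w : List J) :
    (w.map MvPolynomial.X).prod =
      (MvPolynomial.monomial (Multiset.toFinsupp (w : Multiset J)) 1 : MvPolynomial J ℕ) := by
  induction w with
  | nil => simp
  | cons j w ih =>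
    rw [List.map_cons, List.prod_cons, ih, MvPolynomial.X, MvPolynomial.monomial_mul, one_mul,
      ← Multiset.cons_coe, ← Multiset.singleton_add, map_add, Multiset.toFinsupp_singleton]

theorem card_filter_count_ofFn_eq [Fintype J] [DecidableEq J] (c : J → ℕ) :
    Finset.card {p : Fin (∑ j, c j) → J | ∀ j, (List.ofFn p).count j = c j} =
      Nat.multinomial Finset.univ c := by
  set d : J →₀ ℕ := Finsupp.equivFunOnFinite.symm c with hd
  have hsum : d.sum (fun _ m => m) = ∑ j, c j := Finsupp.sum_fintype _ _ fun _ => rfl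
  have hmultinomial : d.multinomial = Nat.multinomial Finset.univ c :=
    Finsupp.multinomial_eq_of_support_subset (Finset.subset_univ _)
  have hcoeff := MvPolynomial.coeff_sum_X_pow_of_fintype (R := ℕ) d (∑ j, c j)
  rw [Fintype.sum_pow, MvPolynomial.coeff_sum, if_pos hsum, hmultinomial, Nat.cast_id] at hcoeff
  rw [Finset.card_filter, ← hcoeff]
  refine Finset.sum_congr rfl fun p _ => ?_
  have hword : (∀ j, (List.ofFn p).count j = c j) ↔
      Multiset.toFinsupp (List.ofFn p : Multiset J) = d := by
    simp [Finsupp.ext_iff, hd]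
  have hprod : ∏ i, MvPolynomial.X (p i) =
      MvPolynomial.monomial (Multiset.toFinsupp (List.ofFn p : Multiset J)) (1 : ℕ) := by
    rw [← prod_map_X_eq_monomial, List.map_ofFn, List.prod_ofFn]
    rfl
  simp only [hprod, MvPolynomial.coeff_monomial, hword]

theorem encard_setOf_count_eq [Fintype J] [DecidableEq J] (c : J → ℕ) :
    {w : List J | ∀ j, w.count j = c j}.encard = Nat.multinomial Finset.univ c := by
  have himage : {w : List J | ∀ j, w.count j = c j} =
      List.ofFn '' {p : Fin (∑ j, c j) → J | ∀ j, (List.ofFn p).count j = c j} := by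
    ext w
    constructor
    · intro hw
      have hlength : w.length = ∑ j, c j := by
        simpa [hw.out] using sum_map_eq_sum_count w fun _ => (1 : ℕ)
      rw [← hlength]
      exact ⟨w.get, by rwa [Set.mem_ofPred_eq, List.ofFn_get], List.ofFn_get w⟩
    · rintro ⟨p, hp, rfl⟩
      exact hp
  rw [himage, List.ofFn_injective.encard_image, ← card_filter_count_ofFn_eq,
    ← Set.encard_coe_eq_coe_finsetCard, Finset.coe_filter_univ]

theorem encard_setOf_exists_count_eq [Fintype J] [DecidableEq J] (C : Finset (J → ℕ)) :
    {w : List J | ∃ c ∈ C, ∀ j, w.count j = c j}.encard =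
      (∑ c ∈ C, Nat.multinomial Finset.univ c : ℕ) := by
  have hset : {w : List J | ∃ c ∈ C, ∀ j, w.count j = c j} =
      ⋃ c ∈ (C : Set (J → ℕ)), {w | ∀ j, w.count j = c j} := by
    ext w
    simp only [Set.mem_ofPred_eq, Set.mem_iUnion, Finset.mem_coe, exists_prop]
  have hdisj : (C : Set (J → ℕ)).PairwiseDisjoint fun c => {w : List J | ∀ j, w.count j = c j} :=
    fun c _ c' _ hne => Set.disjoint_left.2 fun w hw hw' =>
      hne (funext fun j => (hw j).symm.trans (hw' j))
  rw [hset, C.finite_toSet.encard_biUnion hdisj, finsum_mem_coe_finset, Nat.cast_sum]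
  exact Finset.sum_congr rfl fun c _ => encard_setOf_count_eq c

end Words

section GenericLengths

theorem exists_transcendental_mem_Ioo {a b : ℝ} (hab : a < b) :
    ∃ t ∈ Set.Ioo a b, Transcendental ℤ t := by
  obtain ⟨t, ht, hmem⟩ := ((Algebraic.countable ℤ ℝ).dense_compl ℝ).exists_between hab
  exact ⟨t, hmem, ht⟩

theorem linearIndependent_pow_of_transcendental {R A : Type*} [CommRing R] [Ring A] [Algebra R A]
    {t : A} (ht : Transcendental R t) : LinearIndependent R fun n : ℕ => t ^ n := by
  have := (Polynomial.basisMonomials R).linearIndependent.map'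
    (Polynomial.aeval t).toLinearMap (LinearMap.ker_eq_bot.2 (transcendental_iff_injective.1 ht))
  simpa [Function.comp_def, Polynomial.aeval_monomial] using this

theorem exists_linearIndependent_mem_Ioo (κ : Type*) [Countable κ] {η : ℝ} (hη : 0 < η) :
    ∃ v : κ → ℝ, (∀ k, v k ∈ Set.Ioo 0 η) ∧
      LinearIndependent ℤ fun o : Option κ => o.elim 1 v := by
  have := Encodable.ofCountable κ
  obtain ⟨t, ⟨ht0, ht⟩, htrans⟩ := exists_transcendental_mem_Ioo (lt_min hη one_pos)
  obtain ⟨htη, ht1⟩ := lt_min_iff.1 ht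
  refine ⟨fun k => t ^ (Encodable.encode k + 1), fun k => ⟨pow_pos ht0 _, ?_⟩, ?_⟩
  · exact (pow_le_of_le_one ht0.le ht1.le (Nat.succ_ne_zero _)).trans_lt htη
  · have hpow : (fun o : Option κ => o.elim 1 fun k => t ^ (Encodable.encode k + 1)) =
        (fun n => t ^ n) ∘ Encodable.encode := by
      ext o
      cases o <;> simp [Encodable.encode_none, Encodable.encode_some]
    rw [hpow]
    exact (linearIndependent_pow_of_transcendental htrans).comp _ Encodable.encode_injective

variable {κ : Type*}

/-- The real number `a + ∑ k, f k * v k` encoded by an integer vector `(a, f)`, as a linear map.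
Tile lengths and strip lengths are of this form, with `1` and the `v k` linearly independent. -/
noncomputable def lengthMap [Fintype κ] (v : κ → ℝ) : ℤ × (κ → ℤ) →ₗ[ℤ] ℝ :=
  (LinearMap.toSpanSingleton ℤ ℝ 1).coprod (Fintype.linearCombination ℤ v)

theorem lengthMap_apply [Fintype κ] (v : κ → ℝ) (p : ℤ × (κ → ℤ)) :
    lengthMap v p = p.1 + ∑ k, p.2 k * v k := by
  simp [lengthMap, Fintype.linearCombination_apply]

theorem lengthMap_injective [Fintype κ] {v : κ → ℝ}
    (hv : LinearIndependent ℤ fun o : Option κ => o.elim 1 v) :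
    Function.Injective (lengthMap v) := by
  rintro ⟨a, f⟩ ⟨b, g⟩ h
  have heq := Fintype.linearIndependent_iffₛ.1 hv (fun o => o.elim a f) (fun o => o.elim b g)
    (by simpa [lengthMap_apply, Fintype.sum_option] using h)
  exact Prod.ext (heq none) (funext fun k => heq (some k))

theorem lengthMap_pos_of_fst_eq_zero [Fintype κ] {v : κ → ℝ} (hv : ∀ k, 0 < v k)
    {p : ℤ × (κ → ℤ)} (hfst : p.1 = 0) (hsnd : 0 < p.2) : 0 < lengthMap v p := by
  obtain ⟨hnonneg, k, hk⟩ := Pi.lt_def.1 hsnd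
  rw [lengthMap_apply, hfst, Int.cast_zero, zero_add]
  exact Finset.sum_pos' (fun i _ => mul_nonneg (Int.cast_nonneg (hnonneg i)) (hv i).le)
    ⟨k, Finset.mem_univ k, mul_pos (Int.cast_pos.2 hk) (hv k)⟩

theorem lengthMap_pos_of_fst_pos [Fintype κ] {v : κ → ℝ} {η : ℝ} (hv : ∀ k, v k ∈ Set.Ioo 0 η)
    {p : ℤ × (κ → ℤ)} (hfst : 0 < p.1) (hη : (∑ k, |(p.2 k : ℝ)|) * η < 1) :
    0 < lengthMap v p := by
  have hfst' : (1 : ℝ) ≤ p.1 := by exact_mod_cast hfst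
  have hsum : -((∑ k, |(p.2 k : ℝ)|) * η) ≤ ∑ k, p.2 k * v k := by
    rw [Finset.sum_mul, ← Finset.sum_neg_distrib]
    refine Finset.sum_le_sum fun k _ => ?_
    calc -(|(p.2 k : ℝ)| * η) ≤ -(|(p.2 k : ℝ)| * |v k|) :=
          neg_le_neg (mul_le_mul_of_nonneg_left ((abs_of_pos (hv k).1).trans_le (hv k).2.le)
            (abs_nonneg _))
      _ = -|p.2 k * v k| := by rw [abs_mul]
      _ ≤ p.2 k * v k := neg_abs_le _
  rw [lengthMap_apply]
  linarith

theorem exists_lengthMap_injective_pos {J : Type*} [Finite J] [Fintype κ] (vec : J → ℤ × (κ → ℤ))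
    (hpos : ∀ j, 0 < (vec j).1 ∨ (vec j).1 = 0 ∧ 0 < (vec j).2) :
    ∃ v : κ → ℝ, (∀ k, 0 < v k) ∧ Function.Injective (lengthMap v) ∧
      ∀ j, 0 < lengthMap v (vec j) := by
  obtain ⟨B, hB⟩ := (Set.finite_range fun j => ∑ k, |((vec j).2 k : ℝ)|).bddAbove
  have hden : 0 < |B| + 1 := by positivity
  obtain ⟨v, hv, hindep⟩ := exists_linearIndependent_mem_Ioo κ (inv_pos.2 hden)
  refine ⟨v, fun k => (hv k).1, lengthMap_injective hindep, fun j => ?_⟩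
  rcases hpos j with hfst | ⟨hfst, hsnd⟩
  · refine lengthMap_pos_of_fst_pos hv hfst ?_
    rw [← div_eq_mul_inv, div_lt_one hden]
    linarith [hB (Set.mem_range_self j), le_abs_self B]
  · exact lengthMap_pos_of_fst_eq_zero (fun k => (hv k).1) hfst hsnd

theorem isTileCountingFunction_of_vectors {J : Type*} [Fintype J] [Finite κ]
    {vec : J → ℤ × (κ → ℤ)}
    (hinj : Function.Injective vec)
    (hpos : ∀ j, 0 < (vec j).1 ∨ (vec j).1 = 0 ∧ 0 < (vec j).2) {u : κ → ℤ} (hu : 0 ≤ u)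
    (C : ℕ → Finset (J → ℕ)) (hC : ∀ n c, c ∈ C n ↔ ∑ j, c j • vec j = (↑n, u)) :
    IsTileCountingFunction fun n => ∑ c ∈ C n, Nat.multinomial Finset.univ c := by
  classical
  cases nonempty_fintype κ
  obtain ⟨v, hv, hvinj, hvpos⟩ := exists_lengthMap_injective_pos vec hpos
  set len : J → ℝ := fun j => lengthMap v (vec j) with hlen
  have hlenpos : ∀ j, 0 < len j := hvpos
  have hleninj : Function.Injective len := hvinj.comp hinj
  have hδ : 0 ≤ ∑ k, u k * v k :=
    Finset.sum_nonneg fun k _ => mul_nonneg (Int.cast_nonneg (hu k)) (hv k).le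
  refine ⟨rect 0 '' Set.range len, ∑ k, u k * v k, (Set.finite_range len).image _, ?_, hδ,
    fun n => ?_⟩
  · rintro _ ⟨_, ⟨j, rfl⟩, rfl⟩
    exact isTallTile_rect 0 (hlenpos j)
  have hword (w : List J) : (w.map len).sum = n + ∑ k, u k * v k ↔
      ∃ c ∈ C n, ∀ j, w.count j = c j := by
    have hsum : (w.map len).sum = lengthMap v (∑ j, w.count j • vec j) := by
      simp only [sum_map_eq_sum_count, map_sum, map_nsmul, ← nsmul_eq_mul, hlen]
    have htotal : n + ∑ k, u k * v k = lengthMap v (↑n, u) := by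
      rw [lengthMap_apply, Int.cast_natCast]
    rw [hsum, htotal, hvinj.eq_iff, ← hC n fun j => w.count j]
    exact ⟨fun h => ⟨_, h, fun _ => rfl⟩, fun ⟨c, hc, h⟩ => (funext h : _ = c) ▸ hc⟩
  rw [encard_setOf_isTiling_strip_range hlenpos hleninj (by positivity),
    ← encard_setOf_exists_count_eq]
  simp only [hword]

end GenericLengths

section MarkedWords

variable {d D : ℕ} {E : Type*}

/-- The alphabet: `d + 1` base letters, and for each `e : E` an opening marker `.inr (.inl e)` and
a closing marker `.inr (.inr e)`. -/
abbrev Letter (d : ℕ) (E : Type*) : Type _ := Option (Fin d) ⊕ E ⊕ E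

/-- The vectors that encode the lengths of the letters. The base letters add up to `(D, 0)`, the
two markers of `e` add up to `m e` plus one generic length, the strip surplus, and these are the
only integral relations between the letters and the unit and surplus lengths. -/
def letterVec [DecidableEq E] (D : ℕ) (m : E → ℕ) : Letter d E → ℤ × (Fin d ⊕ Option E → ℤ)
  | .inl none => (D, Sum.elim (-1) 0)
  | .inl (some i) => (0, Pi.single (.inl i) 1)
  | .inr (.inl e) => (0, Pi.single (.inr (some e)) 1)
  | .inr (.inr e) => (m e, Pi.single (.inr none) 1 - Pi.single (.inr (some e)) 1)

/-- The letter counts of a word with `k` copies of each base letter and the two markers of `e`. -/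
def letterCount [DecidableEq E] (k : ℕ) (e : E) : Letter d E → ℕ :=
  Sum.elim (fun _ => k) (Sum.elim (Pi.single e 1) (Pi.single e 1))

/-- The number of words with `k` copies of each of `d + 1` letters and two further distinct
letters. -/
def markedWordCount (d k : ℕ) : ℕ :=
  ((d + 1) * k + 2).factorial / k.factorial ^ (d + 1)

theorem multinomial_letterCount [Fintype E] [DecidableEq E] (k : ℕ) (e : E) :
    Nat.multinomial Finset.univ (letterCount (d := d) k e) = markedWordCount d k := by
  have hfactorial (e' : E) : ((Pi.single e 1 : E → ℕ) e').factorial = 1 := by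
    rcases eq_or_ne e' e with rfl | h <;> simp [*]
  simp [Nat.multinomial, markedWordCount, letterCount, Fintype.sum_sum_type,
    Fintype.prod_sum_type, hfactorial]

theorem letterCount_injective2 [DecidableEq E] :
    Function.Injective2 (letterCount (d := d) (E := E)) := by
  intro k k' e e' h
  refine ⟨congrFun h (.inl none), ?_⟩
  have hmarker : (Pi.single e 1 : E → ℕ) e' = (Pi.single e' 1 : E → ℕ) e' :=
    congrFun h (.inr (.inl e'))
  by_contra hne
  simp [Ne.symm hne] at hmarker

theorem letterVec_injective [DecidableEq E] (hD : 0 < D) (m : E → ℕ) :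
    Function.Injective (letterVec (d := d) D m) := by
  intro j j' h
  have hcoord (k) : (letterVec D m j).2 k = (letterVec D m j').2 k :=
    congrFun (congrArg Prod.snd h) k
  have hsurplus := hcoord (.inr none)
  rcases j with (_ | i) | e | e
  · have hunit : (letterVec D m (.inl none)).1 = (letterVec D m j').1 := congrArg Prod.fst h
    rcases j' with (_ | i') | e' | e' <;> simp [letterVec, hD.ne'] at hunit hsurplus ⊢
  · have hself := hcoord (.inl i)
    rcases j' with (_ | i') | e' | e' <;>
      simp only [letterVec, Sum.elim_inl, Pi.neg_apply, Pi.one_apply, Pi.sub_apply] at hself <;>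
      grind
  · have hself := hcoord (.inr (some e))
    rcases j' with (_ | i') | e' | e' <;>
      simp only [letterVec, Sum.elim_inr, Pi.zero_apply, Pi.sub_apply] at hself hsurplus <;> grind
  · have hself := hcoord (.inr (some e))
    rcases j' with (_ | i') | e' | e' <;>
      simp only [letterVec, Sum.elim_inr, Pi.zero_apply, Pi.sub_apply] at hself hsurplus <;> grind

theorem letterVec_pos [DecidableEq E] (hD : 0 < D) {m : E → ℕ} (hm : ∀ e, 0 < m e)
    (j : Letter d E) :
    0 < (letterVec D m j).1 ∨ (letterVec D m j).1 = 0 ∧ 0 < (letterVec D m j).2 := by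
  rcases j with (_ | i) | e | e
  · exact .inl (Int.natCast_pos.2 hD)
  · exact .inr ⟨rfl, Pi.single_pos.2 one_pos⟩
  · exact .inr ⟨rfl, Pi.single_pos.2 one_pos⟩
  · exact .inl (Int.natCast_pos.2 (hm e))

theorem sum_smul_letterVec [Fintype E] [DecidableEq E] (D : ℕ) (m : E → ℕ) (c : Letter d E → ℕ) :
    ∑ j, c j • letterVec D m j =
      (((D * c (.inl none) + ∑ e, m e * c (.inr (.inr e)) : ℕ) : ℤ),
        Sum.elim (fun i => (c (.inl (some i)) : ℤ) - c (.inl none))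
          fun o : Option E => o.elim (∑ e, (c (.inr (.inr e)) : ℤ))
            fun e => (c (.inr (.inl e)) : ℤ) - c (.inr (.inr e))) := by
  ext k
  · simp [Prod.fst_sum, letterVec, Fintype.sum_sum_type, mul_comm]
  · rcases k with i | _ | e <;>
      simp [Prod.snd_sum, letterVec, Fintype.sum_sum_type, Finset.sum_apply, Pi.single_apply,
        sub_eq_add_neg, add_comm]

theorem exists_eq_single_one_of_sum_eq_one [Fintype E] [DecidableEq E] {f : E → ℕ}
    (hf : ∑ e, f e = 1) : ∃ e, f = Pi.single e 1 := by
  obtain ⟨e, he⟩ := (Finsupp.sum_eq_one_iff (Finsupp.equivFunOnFinite.symm f)).1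
    (by simpa [Finsupp.sum_fintype] using hf)
  exact ⟨e, by simpa using congrArg Finsupp.equivFunOnFinite he⟩

theorem sum_smul_letterVec_eq_iff [Fintype E] [DecidableEq E] {m : E → ℕ} {c : Letter d E → ℕ}
    {n : ℕ} : ∑ j, c j • letterVec D m j = (↑n, Pi.single (.inr none) 1) ↔
      ∃ k e, D * k + m e = n ∧ letterCount k e = c := by
  rw [sum_smul_letterVec, Prod.mk.injEq, Nat.cast_inj]
  constructor
  · rintro ⟨htotal, hcoord⟩
    obtain ⟨e, hclose⟩ : ∃ e, (fun e => c (.inr (.inr e))) = Pi.single e 1 :=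
      exists_eq_single_one_of_sum_eq_one
        (by simpa [← Nat.cast_sum] using congrFun hcoord (.inr none))
    have hclose' (e') : c (.inr (.inr e')) = (Pi.single e 1 : E → ℕ) e' := congrFun hclose e'
    have hopen (e') : c (.inr (.inl e')) = c (.inr (.inr e')) := by
      simpa [sub_eq_zero] using congrFun hcoord (.inr (some e'))
    have hbase (i) : c (.inl (some i)) = c (.inl none) := by
      simpa [sub_eq_zero] using congrFun hcoord (.inl i)
    refine ⟨c (.inl none), e, by simpa [hclose', Pi.single_apply] using htotal, funext ?_⟩
    rintro ((_ | i) | e' | e') <;> simp [letterCount, *]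
  · rintro ⟨k, e, rfl, rfl⟩
    refine ⟨by simp [letterCount, Pi.single_apply], funext ?_⟩
    rintro (i | _ | e') <;> simp [letterCount, Pi.single_apply]

theorem isTileCountingFunction_markedWordCount [Fintype E] (d : ℕ) (hD : 0 < D) {m : E → ℕ}
    (hm : ∀ e, 0 < m e) : IsTileCountingFunction fun n =>
      ∑ e with m e ≤ n ∧ m e ≡ n [MOD D], markedWordCount d ((n - m e) / D) := by
  classical
  let counts (n : ℕ) : Finset (Letter d E → ℕ) :=
    Finset.image (fun e => letterCount ((n - m e) / D) e) {e | m e ≤ n ∧ m e ≡ n [MOD D]}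
  have hcounts (n c) : c ∈ counts n ↔
      ∑ j, c j • letterVec D m j = (↑n, Pi.single (.inr none) 1) := by
    rw [sum_smul_letterVec_eq_iff]
    simp only [counts, Finset.mem_image, Finset.mem_filter_univ]
    constructor
    · rintro ⟨e, ⟨hle, hmod⟩, hc⟩
      refine ⟨_, e, ?_, hc⟩
      rw [Nat.mul_div_cancel' ((Nat.modEq_iff_dvd' hle).1 hmod), Nat.sub_add_cancel hle]
    · rintro ⟨k, e, rfl, hc⟩
      exact ⟨e, ⟨Nat.le_add_left .., by simp [Nat.ModEq]⟩, by simpa [hD] using hc⟩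
  convert isTileCountingFunction_of_vectors (letterVec_injective (d := d) hD m)
    (letterVec_pos hD hm) (Pi.single_nonneg.2 zero_le_one) counts hcounts with n
  rw [Finset.sum_image fun e _ e' _ h => (letterCount_injective2 h).2]
  simp only [multinomial_letterCount]

theorem exists_isTileCountingFunction_residues (d : ℕ) (hD : 0 < D) {s : ℕ} (hs : 0 < s)
    (μ : ℕ → ℕ) :
    ∃ f : ℕ → ℕ, IsTileCountingFunction f ∧
      ∀ k, ∀ j < D, f (D * (k + s) + j) = μ j * markedWordCount d k := by
  let m (e : Σ j : Fin D, Fin (μ j)) : ℕ := D * s + e.1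
  refine ⟨_, isTileCountingFunction_markedWordCount d hD (m := m) fun e => by positivity,
    fun k j hj => ?_⟩
  have hmem (e) : (m e ≤ D * (k + s) + j ∧ m e ≡ D * (k + s) + j [MOD D]) ↔ e.1 = ⟨j, hj⟩ := by
    have hmod : m e ≡ D * (k + s) + j [MOD D] ↔ (e.1 : ℕ) = j := by
      simp [m, Nat.ModEq, Nat.mod_eq_of_lt, hj]
    rw [hmod, Fin.ext_iff, and_iff_right_iff_imp]
    intro he
    simp only [m, he]
    gcongr
    exact Nat.le_add_left s k
  calc ∑ e with m e ≤ D * (k + s) + j ∧ m e ≡ D * (k + s) + j [MOD D],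
        markedWordCount d ((D * (k + s) + j - m e) / D)
      = ∑ e : Σ j : Fin D, Fin (μ j) with e.1 = ⟨j, hj⟩, markedWordCount d k := by
        refine Finset.sum_congr (by simp only [hmem]) fun e he => ?_
        have hsub : D * (k + s) + j - m e = D * k := by
          simp only [m, (Finset.mem_filter_univ e).1 he]
          rw [Nat.add_sub_add_right, mul_add, Nat.add_sub_cancel]
        rw [hsub, Nat.mul_div_cancel_left k hD]
    _ = μ j * markedWordCount d k := by
        rw [Finset.sum_filter, Fintype.sum_sigma,
          Fintype.sum_eq_single ⟨j, hj⟩ fun x hx => by simp [hx]]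
        simp

end MarkedWords

section Asymptotics

open scoped Asymptotics Nat

theorem isEquivalent_const_mul_natCast_add {a : ℝ} (ha : a ≠ 0) (b : ℝ) :
    (fun k : ℕ => a * k + b) ~[atTop] fun k => a * k := by
  refine Asymptotics.IsEquivalent.refl.add_const_of_norm_tendsto_atTop ?_
  simpa [Function.comp_def, abs_mul] using
    tendsto_natCast_atTop_atTop.const_mul_atTop (abs_pos.2 ha)

theorem isEquivalent_sqrt {α : Type*} {l : Filter α} {u v : α → ℝ} (hv : 0 ≤ v) (h : u ~[l] v) :
    (fun x => √(u x)) ~[l] fun x => √(v x) := by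
  simp only [Real.sqrt_eq_rpow]
  exact h.rpow hv

theorem isEquivalent_factorial_mul_div_factorial_pow (d : ℕ) :
    (fun k : ℕ => (((d + 1) * k)! : ℝ) / (k ! : ℝ) ^ (d + 1)) ~[atTop]
      fun k => √(d + 1) * ((d + 1 : ℝ) ^ (d + 1)) ^ k / √(2 * Real.pi * k) ^ d := by
  have hmul : Tendsto (fun k : ℕ => (d + 1) * k) atTop atTop :=
    tendsto_id.const_mul_atTop' d.succ_pos
  refine ((Stirling.factorial_isEquivalent_stirling.comp_tendsto hmul).div
    (Stirling.factorial_isEquivalent_stirling.pow (d + 1))).congr_right ?_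
  filter_upwards [eventually_gt_atTop 0] with k hk
  have hsqrt : √(2 * ((d + 1) * k : ℕ) * Real.pi) = √(d + 1) * √(2 * Real.pi * k) := by
    rw [← Real.sqrt_mul (by positivity)]
    push_cast
    ring_nf
  have hpow : (((d + 1) * k : ℕ) / Real.exp 1) ^ ((d + 1) * k) =
      ((d + 1 : ℝ) ^ (d + 1)) ^ k * ((k / Real.exp 1) ^ k) ^ (d + 1) := by
    rw [← pow_mul, ← pow_mul, mul_comm k, ← mul_pow]
    push_cast
    ring_nf
  simp only [Pi.div_apply, Pi.pow_apply, Function.comp_apply, hsqrt, hpow]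
  rw [mul_right_comm 2 (k : ℝ)]
  field_simp
  ring

theorem isEquivalent_catalan :
    (fun n => (catalan n : ℝ)) ~[atTop] fun n => 4 ^ n / (√Real.pi * √n ^ 3) := by
  have hcatalan (n : ℕ) : (catalan n : ℝ) = ((1 + 1) * n)! / (n ! : ℝ) ^ (1 + 1) / (1 * n + 1) := by
    rw [eq_div_iff (by positivity), one_mul, mul_comm, one_add_one_eq_two, sq,
      ← Nat.cast_succ, ← Nat.cast_mul, succ_mul_catalan_eq_centralBinom,
      Nat.centralBinom_eq_two_mul_choose,
      Nat.cast_choose ℝ (Nat.le_mul_of_pos_left n two_pos), two_mul, Nat.add_sub_cancel]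
  simp only [hcatalan]
  refine ((isEquivalent_factorial_mul_div_factorial_pow 1).div
    (isEquivalent_const_mul_natCast_add one_ne_zero 1)).congr_right ?_
  filter_upwards [eventually_gt_atTop 0] with n hn
  have hcube : √(n : ℝ) ^ 3 = n * √n := by rw [pow_succ, Real.sq_sqrt n.cast_nonneg]
  have hroot : √(2 * Real.pi * n) = √2 * √Real.pi * √n := by
    rw [Real.sqrt_mul (by positivity), Real.sqrt_mul zero_le_two]
  rw [Pi.div_apply, hroot, hcube]
  norm_num
  field_simp

theorem isEquivalent_catalan_mul_add {a : ℕ} (ha : 0 < a) (b : ℕ) :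
    (fun k => (catalan (a * k + b) : ℝ)) ~[atTop] fun k => 4 ^ b * (catalan (a * k) : ℝ) := by
  have hshift (b : ℕ) : (fun k => (catalan (a * k + b) : ℝ)) ~[atTop]
      fun k => 4 ^ (a * k + b) / (√Real.pi * √(a * k) ^ 3) := by
    have htendsto : Tendsto (fun k => a * k + b) atTop atTop :=
      tendsto_atTop_mono (fun k => Nat.le_add_right _ b) (tendsto_id.const_mul_atTop' ha)
    have hlinear : (fun k : ℕ => ((a * k + b : ℕ) : ℝ)) ~[atTop] fun k => (a * k : ℝ) := by
      simpa using isEquivalent_const_mul_natCast_add (Nat.cast_ne_zero.2 ha.ne') b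
    exact (isEquivalent_catalan.comp_tendsto htendsto).trans <| .div .refl <|
      .mul .refl <| (isEquivalent_sqrt (fun k => by positivity) hlinear).pow 3
  refine (hshift b).trans (((Asymptotics.IsEquivalent.refl (u := fun _ => 4 ^ b)).mul
    (hshift 0)).congr_right (.of_forall fun k => ?_)).symm
  simp only [Pi.mul_apply, add_zero, pow_add]
  ring

theorem cast_markedWordCount (d k : ℕ) :
    (markedWordCount d k : ℝ) =
      (((d + 1) * k)! : ℝ) / (k ! : ℝ) ^ (d + 1) * (((d + 1) * k + 1) * ((d + 1) * k + 2)) := by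
  have hdvd : k ! ^ (d + 1) ∣ ((d + 1) * k)! := by
    simpa using Nat.prod_factorial_dvd_factorial_sum (Finset.range (d + 1)) fun _ => k
  rw [markedWordCount, Nat.cast_div (hdvd.trans (Nat.factorial_dvd_factorial (Nat.le_add_right ..)))
    (by positivity), Nat.factorial_succ, Nat.factorial_succ]
  push_cast
  ring

theorem isEquivalent_markedWordCount (d : ℕ) :
    (fun k => (markedWordCount d k : ℝ)) ~[atTop] fun k =>
      √(d + 1) * ((d + 1 : ℝ) ^ (d + 1)) ^ k / √(2 * Real.pi * k) ^ d * ((d + 1) * k) ^ 2 := by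
  simp only [cast_markedWordCount, sq]
  have hd : (d + 1 : ℝ) ≠ 0 := by positivity
  exact (isEquivalent_factorial_mul_div_factorial_pow d).mul
    ((isEquivalent_const_mul_natCast_add hd 1).mul (isEquivalent_const_mul_natCast_add hd 2))

theorem isEquivalent_markedWordCount_seven :
    (fun k => (markedWordCount 7 k : ℝ)) ~[atTop]
      fun k => 384 * √3 / Real.pi ^ 3 * (catalan (12 * k) : ℝ) := by
  have hcatalan := isEquivalent_catalan.comp_tendsto
    (tendsto_id.const_mul_atTop' (show 0 < 12 by norm_num))
  refine (isEquivalent_markedWordCount 7).trans (((Asymptotics.IsEquivalent.refl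
    (u := fun _ => 384 * √3 / Real.pi ^ 3)).mul hcatalan).congr_right ?_).symm
  filter_upwards [eventually_gt_atTop 0] with k hk
  have hroot : √(2 * Real.pi * k) ^ 7 = (2 * Real.pi * k) ^ 3 * (√2 * √Real.pi * √k) := by
    rw [pow_succ, pow_mul _ 2 3, Real.sq_sqrt (by positivity), Real.sqrt_mul (by positivity),
      Real.sqrt_mul zero_le_two]
  have hroot12 : √((12 * k : ℕ) : ℝ) ^ 3 = 12 * k * (2 * √3 * √k) := by
    rw [pow_succ, Real.sq_sqrt (Nat.cast_nonneg _), Nat.cast_mul, Real.sqrt_mul (by positivity),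
      Nat.cast_ofNat, show (12 : ℝ) = 2 ^ 2 * 3 by norm_num, Real.sqrt_mul (by positivity),
      Real.sqrt_sq zero_le_two]
  have hsqrt8 : √(7 + 1) = 2 * √2 := by
    rw [show (7 + 1 : ℝ) = 2 ^ 2 * 2 by norm_num, Real.sqrt_mul (by positivity),
      Real.sqrt_sq zero_le_two]
  have hpow : ((7 + 1 : ℝ) ^ (7 + 1)) ^ k = 4 ^ (12 * k) := by
    rw [pow_mul]
    norm_num
  simp only [Pi.mul_apply, Function.comp_apply, id, Nat.cast_ofNat, hroot, hroot12, hsqrt8, hpow]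
  field_simp
  norm_num

theorem tendsto_of_tendsto_mul_add {α : Type*} {u : ℕ → α} {l : Filter α} {D : ℕ} (hD : 0 < D)
    (h : ∀ j < D, Tendsto (fun k => u (D * k + j)) atTop l) : Tendsto u atTop l := by
  intro s hs
  have hev : ∀ᶠ k in atTop, ∀ j ∈ Finset.range D, u (D * k + j) ∈ s :=
    (Finset.eventually_all _).2 fun j hj => h j (Finset.mem_range.1 hj) hs
  refine mem_map.2 ?_
  filter_upwards [(Nat.tendsto_div_const_atTop hD.ne').eventually hev] with n hn
  rw [Set.mem_preimage, ← Nat.div_add_mod n D]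
  exact hn (n % D) (Finset.mem_range.2 (Nat.mod_lt n hD))

theorem catalan_ne_zero (n : ℕ) : catalan n ≠ 0 :=
  right_ne_zero_of_mul (succ_mul_catalan_eq_centralBinom n ▸ n.centralBinom_ne_zero)

theorem asymptoticTo_catalan_of_residues {f w : ℕ → ℕ} {a M s : ℕ} {c : ℝ} (ha : 0 < a)
    (hM : 0 < M) (hc : c ≠ 0)
    (hw : (fun k => (w k : ℝ)) ~[atTop] fun k => c * (catalan (a * k) : ℝ))
    (hf : ∀ k, ∀ j < a, f (a * (k + s) + j) = M * 4 ^ j * w k) :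
    AsymptoticTo (fun n => (f n : ℝ)) fun n => M * c / (4 ^ a) ^ s * (catalan n : ℝ) := by
  refine tendsto_of_tendsto_mul_add ha fun j hj => (tendsto_add_atTop_iff_nat s).1 ?_
  set A : ℝ := M * c / (4 ^ a) ^ s with hA
  have hAne : A ≠ 0 := by positivity
  have hindex (k : ℕ) : a * (k + s) + j = a * k + (a * s + j) := by ring
  have hA4 : A * 4 ^ (a * s + j) = M * 4 ^ j * c := by
    rw [hA, pow_add, pow_mul]
    field_simp
  have hcount : (fun k => (f (a * (k + s) + j) : ℝ)) ~[atTop]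
      fun k => A * (catalan (a * (k + s) + j) : ℝ) := by
    simp only [hf _ j hj]
    push_cast [hindex]
    refine ((Asymptotics.IsEquivalent.refl (u := fun _ => (M * 4 ^ j : ℝ))).mul hw).trans <|
      (((Asymptotics.IsEquivalent.refl (u := fun _ => A)).mul
        (isEquivalent_catalan_mul_add ha (a * s + j))).congr_right ?_).symm
    refine .of_forall fun k => ?_
    simp only [Pi.mul_apply]
    rw [← mul_assoc, hA4, mul_assoc]
  refine (Asymptotics.isEquivalent_iff_tendsto_one (.of_forall fun k => ?_)).1 hcount
  exact mul_ne_zero hAne (Nat.cast_ne_zero.2 (catalan_ne_zero _))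

theorem exists_natCast_mul_div_pow_mem_Ioo {b c ε : ℝ} (hb : 1 < b) (hc : 0 < c) (hε : 0 < ε) :
    ∃ M s : ℕ, 0 < M ∧ 0 < s ∧ M * c / b ^ s ∈ Set.Ioo (1 - ε) (1 + ε) := by
  have hlim : Tendsto (fun s : ℕ => ⌊c⁻¹ * b ^ s⌋₊ / b ^ s * c) atTop (𝓝 1) := by
    simpa [hc.ne'] using ((tendsto_nat_floor_mul_div_atTop (inv_nonneg.2 hc.le)).comp
      (tendsto_pow_atTop_atTop_of_one_lt hb)).mul_const c
  obtain ⟨s, hs, hpos, hmem⟩ := ((eventually_gt_atTop 0).and ((hlim.eventually_const_lt one_pos).and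
    (hlim.eventually (Ioo_mem_nhds (sub_lt_self 1 hε) (lt_add_of_pos_right 1 hε))))).exists
  rw [div_mul_eq_mul_div] at hmem
  refine ⟨_, s, Nat.pos_of_ne_zero fun hzero => ?_, hs, hmem⟩
  simp [hzero] at hpos

end Asymptotics

end IrrationalTilings

open IrrationalTilings in
theorem mainTheorem6 (ε : ℝ) (hε : 0 < ε) :
    ∃ f : ℕ → ℕ, IrrationalTilings.IsTileCountingFunction f ∧
      ∃ A ∈ Set.Ioo (1 - ε) (1 + ε),
        IrrationalTilings.AsymptoticTo (fun n => (f n : ℝ)) (fun n => A * (catalan n : ℝ)) := by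
  have hc : 0 < 384 * √3 / Real.pi ^ 3 := by positivity
  obtain ⟨M, s, hM, hs, hA⟩ :=
    exists_natCast_mul_div_pow_mem_Ioo (show (1 : ℝ) < 4 ^ 12 by norm_num) hc hε
  obtain ⟨f, hf, hresidues⟩ :=
    exists_isTileCountingFunction_residues 7 (D := 12) (by norm_num) hs fun j => M * 4 ^ j
  exact ⟨f, hf, _, hA, asymptoticTo_catalan_of_residues (by norm_num) hM hc.ne'
    isEquivalent_markedWordCount_seven hresidues⟩
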